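/- Let $0<\alpha<1$, $\epsilon>0$, $\delta>0$, and let $N,M\ge 1$ be integers. Let $x\in\mathbb{R}^N$ be a nonzero (deterministic) vector with exactly $K$ nonzero coordinates. Let $S=(s_{ij})\in\mathbb{R}^{N\times M}$ be a random matrix whose entries are i.i.d. with the symmetric $\alpha$-stable law $S(\alpha,1)$, i.e. $E\,e^{\sqrt{-1}\,t s_{ij}}=e^{-|t|^\alpha}$ for all $t\in\mathbb{R}$. Let $y=xS$, i.e. $y_j=\sum_{i=1}^N x_i s_{ij}$ for $1\le j\le M$, and for each $i$ let $$\hat{x}_{i,\min}=\frac{y_t}{s_{it}},\qquad t=\underset{1\le j\le M}{\operatorname{argmin}}\left|\frac{y_j}{s_{ij}}\right|$$ be the absolute minimum estimator. A coordinate $i$ is called a false positive if $x_i=0$ and $|\hat{x}_{i,\min}|>\epsilon$. Put $$\theta=\Big(\sum_{i=1}^N|x_i|^\alpha\Big)^{1/\alpha},\qquad \psi=\left(\frac{\epsilon}{\theta}\right)^{\alpha/(1-\alpha)},$$ and assume $\psi\le 1/3$. If $$M\ \ge\ \frac{\log\left((N-K)/\delta\right)}{\log(1+\psi)}$$ (for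 $N=K$ this condition is void), then the expected number of false positives is at most $\delta$; moreover, with probability at least $1-\delta$ there is no false positive at all. -/

import Mathlib

open MeasureTheory ProbabilityTheory
open scoped Matrix

namespace StableCS

/-- `μ` is the symmetric `α`-stable law `S(α,1)` with unit scale: `0 < α ≤ 2` and its
characteristic function is `t ↦ exp (-|t|^α)`. -/
structure IsStdStable (α : ℝ) (μ : Measure ℝ) : Prop where
  pos : 0 < α
  le_two : α ≤ 2
  prob : IsProbabilityMeasure μ
  charFun_eq : ∀ t : ℝ, charFun μ t = Complex.exp (-((|t| ^ α : ℝ) : ℂ))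

/-- The design matrix `S` is random with i.i.d. entries distributed as `S(α,1)`. -/
structure IsStableDesign {Ω : Type*} [MeasurableSpace Ω] (P : Measure Ω) {N M : ℕ} (α : ℝ)
    (S : Ω → Matrix (Fin N) (Fin M) ℝ) : Prop where
  measurable_entry : ∀ i j, Measurable fun ω => S ω i j
  law_entry : ∀ i j, IsStdStable α (P.map fun ω => S ω i j)
  indep : iIndepFun (fun (p : Fin N × Fin M) (ω : Ω) => S ω p.1 p.2) P

/-- The ratio statistics `z_{ij} = y_j / s_{ij}`. -/
noncomputable def ratioStat {N M : ℕ} (y : Fin M → ℝ) (S : Matrix (Fin N) (Fin M) ℝ)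
    (i : Fin N) (j : Fin M) : ℝ :=
  y j / S i j

/-- An index at which `|z_j|` is minimal (ties are broken arbitrarily). -/
noncomputable def absArgmin {M : ℕ} [NeZero M] (z : Fin M → ℝ) : Fin M :=
  Classical.choose (Finite.exists_min fun j => |z j|)

theorem absArgmin_spec {M : ℕ} [NeZero M] (z : Fin M → ℝ) (j : Fin M) :
    |z (absArgmin z)| ≤ |z j| :=
  Classical.choose_spec (Finite.exists_min fun j => |z j|) j

/-- The absolute minimum estimator `y_t / s_{it}`, where `t = argmin_j |y_j / s_{ij}|`. -/
noncomputable def minEstimator {N M : ℕ} [NeZero M] (y : Fin M → ℝ)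
    (S : Matrix (Fin N) (Fin M) ℝ) (i : Fin N) : ℝ :=
  ratioStat y S i (absArgmin (ratioStat y S i))

/-- The false positives at threshold `ε`, for the measurements `y = x S`: the coordinates `i`
with `x_i = 0` at which the absolute minimum estimator exceeds `ε` in absolute value. -/
noncomputable def falsePositives {N M : ℕ} [NeZero M] (ε : ℝ) (x : Fin N → ℝ)
    (S : Matrix (Fin N) (Fin M) ℝ) : Finset (Fin N) :=
  {i | x i = 0 ∧ ε < |minEstimator (x ᵥ* S) S i|}

/-- `θ = (∑ |x_i|^α)^(1/α)`. -/
noncomputable def theta {N : ℕ} (α : ℝ) (x : Fin N → ℝ) : ℝ :=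
  (∑ i, |x i| ^ α) ^ (1 / α)

/-- `ψ = (ε/θ)^(α/(1-α))`. -/
noncomputable def psi {N : ℕ} (α ε : ℝ) (x : Fin N → ℝ) : ℝ :=
  (ε / theta α x) ^ (α / (1 - α))

end StableCS

open scoped FourierTransform

namespace StableCS

/-! If `x i = 0`, then `y_j / θ` is a combination of entries other than `s_{ij}` whose coefficients
have `α`-norm one. So it is a standard stable variable `s'` independent of `s = s_{ij}`, and the
whole matter is the bound `P(|s'| ≤ r|s|) ≥ ψ/(1+ψ)` with `r = ε/θ`, `ψ = r^(α/(1-α))`. Given it,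
independence of the columns bounds the chance that all `M` ratios exceed `ε` by `(1+ψ)^(-M)`.
Summing over the `N - K` zero coordinates bounds the expected count by `δ`, and the union bound
gives the second claim.

The bound rests on a representation `|s|^(α/(1-α)) = D/W` with `W` exponential and independent of `D
> 0` (`IsStdStable.lintegral_abs_rpow`). With independent copies, the event reads `W ≥ c W'` for `c
= D/(ψ D')`, and has conditional probability `1/(1+c)`. Exchanging `D` and `D'` and averaging
reduces the claim to an inequality between real numbers, true for `ψ ≤ 1`
(`two_mul_div_one_add_le`).

The representation writes `s` as a Cauchy variable times an independent positive stable variable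
(`IsStdStable.eq_map`), the latter in Kanter's form `(W^(1-α) κ(U))^(-1/α)`, where `κ` is `kanter α`
and `U` is uniform on `(0, π)`. Kanter's form is verified through moments: `E^α W^(1-α) κ(U)`, with
`E` another independent exponential variable, has `n`-th moment `n!`. This needs the exact value of
`∫ κ^n` (`integral_kanter_pow`). -/

/-! ### Binomial sums of sinc values and the reciprocal Gamma function -/

theorem inv_Gamma_eq_mul_inv_Gamma_add_one (s : ℝ) :
    (Real.Gamma s)⁻¹ = s * (Real.Gamma (s + 1))⁻¹ := by
  -- `Real.Gamma` is `0` at its poles, so its inverse there agrees with the entire function `1/Γ`.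
  rcases eq_or_ne s 0 with rfl | hs
  · simp
  · rw [Real.Gamma_add_one hs, mul_inv, mul_inv_cancel_left₀ hs]

theorem sinc_pi_mul_eq_inv_Gamma (x : ℝ) :
    Real.sinc (Real.pi * (-x)) = (Real.Gamma (x + 1))⁻¹ * (Real.Gamma (1 - x))⁻¹ := by
  rcases eq_or_ne x 0 with rfl | hx
  · simp
  · have hπ := Real.pi_ne_zero
    rw [mul_neg, Real.sinc_neg, Real.sinc_of_ne_zero (mul_ne_zero hπ hx), Real.Gamma_add_one hx,
      mul_inv, mul_assoc, ← mul_inv, Real.Gamma_mul_Gamma_one_sub, inv_div]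
    field_simp

/-- By Pascal's rule the sum for `n + 1` at `x` is the sum for `n` at `x` plus that at `x - 1`; the
right side obeys the same recursion because `(n - x + 1) + x = n + 1`. The case `n = 0` is Euler's
reflection formula. -/
theorem sum_choose_mul_sinc (n : ℕ) (x : ℝ) :
    ∑ k ∈ Finset.range (n + 1), (n.choose k : ℝ) * Real.sinc (Real.pi * (k - x)) =
      n.factorial * ((Real.Gamma (x + 1))⁻¹ * (Real.Gamma (n - x + 1))⁻¹) := by
  induction n generalizing x with
  | zero => simpa [add_comm, sub_eq_add_neg] using sinc_pi_mul_eq_inv_Gamma x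
  | succ n ih =>
    have key : ∑ k ∈ Finset.range (n + 1 + 1),
        ((n + 1).choose k : ℝ) * Real.sinc (Real.pi * (k - x)) =
        (∑ k ∈ Finset.range (n + 1), (n.choose k : ℝ) * Real.sinc (Real.pi * (k - x))) +
        ∑ k ∈ Finset.range (n + 1), (n.choose k : ℝ) * Real.sinc (Real.pi * (k - (x - 1))) := by
      rw [Finset.sum_range_succ' _ (n + 1)]
      have h1 : ∑ k ∈ Finset.range (n + 1), (n.choose k : ℝ) * Real.sinc (Real.pi * (k - x)) =
          ∑ k ∈ Finset.range (n + 1),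
            (n.choose (k + 1) : ℝ) * Real.sinc (Real.pi * ((k + 1 : ℕ) - x)) +
            Real.sinc (Real.pi * (0 - x)) := by
        have := Finset.sum_range_succ' (fun k => (n.choose k : ℝ) *
          Real.sinc (Real.pi * (k - x))) (n + 1)
        rw [Finset.sum_range_succ] at this
        simpa using this
      rw [h1, add_right_comm, ← Finset.sum_add_distrib]
      simp only [Nat.choose_zero_right, Nat.cast_zero, Nat.cast_one, one_mul]
      congr 1
      refine Finset.sum_congr rfl fun k _ => ?_
      rw [Nat.choose_succ_succ]
      push_cast
      rw [show (k : ℝ) - (x - 1) = k + 1 - x by ring]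
      ring
    rw [key, ih, ih, sub_add_cancel, inv_Gamma_eq_mul_inv_Gamma_add_one x,
      inv_Gamma_eq_mul_inv_Gamma_add_one (n - x + 1),
      show (n : ℝ) - (x - 1) + 1 = n - x + 1 + 1 by ring, Nat.factorial_succ]
    push_cast
    rw [show (n : ℝ) + 1 - x + 1 = n - x + 1 + 1 by ring]
    ring

/-! ### Kanter's kernel and the integrals of its powers -/

/-- `sin (α u) / sin ((1 - α) u)`, extended continuously to `u = 0`. -/
noncomputable def sinRatio (α u : ℝ) : ℝ :=
  α * Real.sinc (α * u) / ((1 - α) * Real.sinc ((1 - α) * u))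

/-- Kanter's kernel `sin u / (sin ((1 - α) u) ^ (1 - α) * sin (α u) ^ α)`, extended continuously
to `u = 0`. -/
noncomputable def kanter (α u : ℝ) : ℝ :=
  Real.sinc u / ((1 - α) * Real.sinc ((1 - α) * u)) * sinRatio α u ^ (-α)

theorem sinc_pos {u : ℝ} (h0 : 0 ≤ u) (hπ : u < Real.pi) : 0 < Real.sinc u := by
  rcases h0.eq_or_lt with rfl | h
  · simp
  · rw [Real.sinc_of_ne_zero h.ne']
    exact div_pos (Real.sin_pos_of_pos_of_lt_pi h hπ) h

theorem sinc_mul_pos {α u : ℝ} (hα0 : 0 < α) (hα1 : α < 1) (hu : u ∈ Set.Icc 0 Real.pi) :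
    0 < Real.sinc (α * u) :=
  sinc_pos (mul_nonneg hα0.le hu.1) (by nlinarith [hu.1, hu.2, Real.pi_pos])

theorem sinRatio_pos {α u : ℝ} (hα0 : 0 < α) (hα1 : α < 1) (hu : u ∈ Set.Icc 0 Real.pi) :
    0 < sinRatio α u := by
  have h1 := sinc_mul_pos hα0 hα1 hu
  have h2 := sinc_mul_pos (α := 1 - α) (by linarith) (by linarith) hu
  have : 0 < 1 - α := by linarith
  unfold sinRatio
  positivity

theorem continuousOn_sinRatio {α : ℝ} (hα0 : 0 < α) (hα1 : α < 1) :
    ContinuousOn (sinRatio α) (Set.Icc 0 Real.pi) := by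
  unfold sinRatio
  refine ContinuousOn.div ?_ ?_ fun u hu => ?_
  · exact (continuous_const.mul (Real.continuous_sinc.comp (by fun_prop))).continuousOn
  · exact (continuous_const.mul (Real.continuous_sinc.comp (by fun_prop))).continuousOn
  · have h2 := sinc_mul_pos (α := 1 - α) (by linarith) (by linarith) hu
    have : 0 < 1 - α := by linarith
    positivity

theorem kanter_pos {α u : ℝ} (hα0 : 0 < α) (hα1 : α < 1) (hu : u ∈ Set.Ioo 0 Real.pi) :
    0 < kanter α u := by
  have h1 := sinRatio_pos hα0 hα1 ⟨hu.1.le, hu.2.le⟩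
  have h2 := sinc_mul_pos (α := 1 - α) (by linarith) (by linarith) ⟨hu.1.le, hu.2.le⟩
  have h3 := sinc_pos hu.1.le hu.2
  have : 0 < 1 - α := by linarith
  unfold kanter
  positivity

theorem continuousOn_kanter {α : ℝ} (hα0 : 0 < α) (hα1 : α < 1) :
    ContinuousOn (kanter α) (Set.Icc 0 Real.pi) := by
  unfold kanter
  refine ContinuousOn.mul (ContinuousOn.div ?_ ?_ fun u hu => ?_) ?_
  · exact Real.continuous_sinc.continuousOn
  · exact (continuous_const.mul (Real.continuous_sinc.comp (by fun_prop))).continuousOn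
  · have h2 := sinc_mul_pos (α := 1 - α) (by linarith) (by linarith) hu
    have : 0 < 1 - α := by linarith
    positivity
  · exact (continuousOn_sinRatio hα0 hα1).rpow_const
      fun u hu => Or.inl (sinRatio_pos hα0 hα1 hu).ne'

theorem measurable_kanter (α : ℝ) : Measurable (kanter α) := by
  have := Real.continuous_sinc.measurable
  unfold kanter sinRatio
  fun_prop

theorem sinRatio_eq {α u : ℝ} (hα0 : 0 < α) (hα1 : α < 1) (hu : u ≠ 0) :
    sinRatio α u = Real.sin (α * u) / Real.sin ((1 - α) * u) := by
  have : 1 - α ≠ 0 := by linarith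
  rw [sinRatio, Real.sinc_of_ne_zero (by positivity), Real.sinc_of_ne_zero (by positivity)]
  field_simp

/-- This is the law of sines in the triangle with vertices `0`, `1`, `1 + z`, where `z = sinRatio α
u * exp (i u)`: the choice of modulus gives `1 + z` the argument `α u`. Hence `(1 + z) z^(-α)` is
real, with value `kanter α u`. -/
theorem one_add_sinRatio_mul_exp {α u : ℝ} (hα0 : 0 < α) (hα1 : α < 1)
    (hu : u ∈ Set.Ioo 0 Real.pi) :
    1 + (sinRatio α u : ℂ) * Complex.exp (u * Complex.I) =
      (Real.sinc u / ((1 - α) * Real.sinc ((1 - α) * u)) : ℝ) *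
        Complex.exp ((α * u : ℝ) * Complex.I) := by
  have hs : 0 < Real.sin ((1 - α) * u) :=
    Real.sin_pos_of_pos_of_lt_pi (mul_pos (by linarith) hu.1) (by nlinarith [hu.1, hu.2])
  have h1 : (1 - α) * u ≠ 0 := (mul_pos (by linarith) hu.1).ne'
  have h2 : 1 - α ≠ 0 := by linarith
  have h3 : u ≠ 0 := hu.1.ne'
  have hρ : Real.sinc u / ((1 - α) * Real.sinc ((1 - α) * u)) =
      Real.sin u / Real.sin ((1 - α) * u) := by
    rw [Real.sinc_of_ne_zero h1, Real.sinc_of_ne_zero h3]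
    field_simp
  rw [hρ, sinRatio_eq hα0 hα1 h3, Complex.exp_mul_I, Complex.exp_mul_I, ← Complex.ofReal_cos,
    ← Complex.ofReal_sin, ← Complex.ofReal_cos, ← Complex.ofReal_sin]
  have hexp : Real.sin ((1 - α) * u) =
      Real.sin u * Real.cos (α * u) - Real.cos u * Real.sin (α * u) := by
    rw [← Real.sin_sub]; ring_nf
  apply Complex.ext
  · rw [Complex.add_re, Complex.re_ofReal_mul, Complex.re_ofReal_mul]
    simp only [Complex.add_re, Complex.one_re, Complex.re_ofReal_mul, Complex.ofReal_re,
      Complex.I_re, mul_zero, add_zero]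
    rw [div_mul_eq_mul_div, div_mul_eq_mul_div, eq_div_iff hs.ne', add_mul,
      div_mul_cancel₀ _ hs.ne']
    linarith
  · rw [Complex.add_im, Complex.im_ofReal_mul, Complex.im_ofReal_mul]
    simp only [Complex.add_im, Complex.one_im, Complex.im_ofReal_mul, Complex.ofReal_im,
      Complex.I_im, mul_one, zero_add]
    ring

theorem sum_choose_mul_sinRatio_rpow_mul_exp {α u : ℝ} (hα0 : 0 < α) (hα1 : α < 1)
    (hu : u ∈ Set.Ioo 0 Real.pi) (n : ℕ) :
    ∑ k ∈ Finset.range (n + 1), ((n.choose k * sinRatio α u ^ ((k : ℝ) - α * n) : ℝ) : ℂ) *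
        Complex.exp (((k - α * n) * u : ℝ) * Complex.I) = ((kanter α u ^ n : ℝ) : ℂ) := by
  have hr := sinRatio_pos hα0 hα1 ⟨hu.1.le, hu.2.le⟩
  have hb := add_pow ((sinRatio α u : ℂ) * Complex.exp (u * Complex.I)) 1 n
  rw [add_comm, one_add_sinRatio_mul_exp hα0 hα1 hu] at hb
  -- The factor in front of the binomial term is `z^(-αn)`: its phases combine to `exp (-i α n u)`.
  have h1 : ∀ k : ℕ, ((n.choose k * sinRatio α u ^ ((k : ℝ) - α * n) : ℝ) : ℂ) *
        Complex.exp (((k - α * n) * u : ℝ) * Complex.I) =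
      (((sinRatio α u ^ (-α)) ^ n : ℝ) * Complex.exp ((α * u : ℝ) * Complex.I) ^ n * (Complex.exp
        ((α * u : ℝ) * Complex.I) ^ n)⁻¹ ^ 2) *
      (((sinRatio α u : ℂ) * Complex.exp (u * Complex.I)) ^ k * 1 ^ (n - k) * n.choose k) := by
    intro k
    have e1 : sinRatio α u ^ ((k : ℝ) - α * n) = (sinRatio α u ^ (-α)) ^ n * sinRatio α u ^ k := by
      rw [← Real.rpow_natCast, ← Real.rpow_natCast, ← Real.rpow_mul hr.le, ← Real.rpow_add hr]
      ring_nf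
    have e2 : Complex.exp (((k - α * n) * u : ℝ) * Complex.I) =
        Complex.exp (u * Complex.I) ^ k * (Complex.exp ((α * u : ℝ) * Complex.I) ^ n)⁻¹ := by
      rw [← Complex.exp_nat_mul, ← Complex.exp_nat_mul, ← Complex.exp_neg, ← Complex.exp_add]
      congr 1
      push_cast
      ring
    have e3 : Complex.exp ((α * u : ℝ) * Complex.I) ^ n ≠ 0 := pow_ne_zero _ (Complex.exp_ne_zero _)
    rw [e1, e2]
    push_cast at e3 ⊢
    field_simp
    ring
  have e3 : Complex.exp ((α * u : ℝ) * Complex.I) ^ n ≠ 0 := pow_ne_zero _ (Complex.exp_ne_zero _)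
  rw [Finset.sum_congr rfl fun k _ => h1 k, ← Finset.mul_sum, ← hb, kanter]
  push_cast at e3 ⊢
  simp only [mul_pow]
  field_simp

/-- An antiderivative of `kanter α u ^ n`. -/
noncomputable def kanterPrimitive (α : ℝ) (n : ℕ) (u : ℝ) : ℝ :=
  ∑ k ∈ Finset.range (n + 1), (n.choose k : ℝ) *
    (sinRatio α u ^ ((k : ℝ) - α * n) * (u * Real.sinc ((k - α * n) * u)))

theorem continuousOn_kanterPrimitive {α : ℝ} (hα0 : 0 < α) (hα1 : α < 1) (n : ℕ) :
    ContinuousOn (kanterPrimitive α n) (Set.Icc 0 Real.pi) := by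
  unfold kanterPrimitive
  refine continuousOn_finsetSum _ fun k _ => continuousOn_const.mul (ContinuousOn.mul ?_ ?_)
  · exact (continuousOn_sinRatio hα0 hα1).rpow_const
      fun u hu => Or.inl (sinRatio_pos hα0 hα1 hu).ne'
  · exact (continuous_id.mul (Real.continuous_sinc.comp (by fun_prop))).continuousOn

/-- The form `v * sinc (a v)` replaces `sin (a v) / a` so that `a = k - α n` may vanish. -/
theorem mul_sinc_mul_hasDerivAt (a : ℝ) {u : ℝ} :
    HasDerivAt (fun v => v * Real.sinc (a * v)) (Real.cos (a * u)) u := by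
  rcases eq_or_ne a 0 with rfl | ha
  · simpa using hasDerivAt_id' u
  · have : (fun v => v * Real.sinc (a * v)) = fun v => Real.sin (a * v) / a := by
      funext v
      rcases eq_or_ne v 0 with rfl | hv
      · simp
      · rw [Real.sinc_of_ne_zero (mul_ne_zero ha hv)]
        field_simp
    rw [this]
    have h := (((hasDerivAt_id u).const_mul a).sin).div_const a
    simpa [ha] using h

theorem mul_mul_sinc (a u : ℝ) : a * (u * Real.sinc (a * u)) = Real.sin (a * u) := by
  rcases eq_or_ne (a * u) 0 with h | h
  · rw [← mul_assoc, h]; simp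
  · rw [Real.sinc_of_ne_zero h, ← mul_assoc, mul_div_cancel₀ _ h]

/-- `kanterPrimitive` is the imaginary part of a termwise antiderivative of `(1 + z)^n z^(-αn) dz/z`
along the curve `z(u)`. There `(1 + z)^n z^(-αn) = kanter α u ^ n` is real and `dz/z = (r'/r + i)
du` with `r = sinRatio α u`, so the imaginary part has derivative `kanter α u ^ n`. -/
theorem hasDerivAt_kanterPrimitive {α u : ℝ} (hα0 : 0 < α) (hα1 : α < 1)
    (hu : u ∈ Set.Ioo 0 Real.pi) (n : ℕ) :
    HasDerivAt (kanterPrimitive α n) (kanter α u ^ n) u := by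
  have hr := sinRatio_pos hα0 hα1 ⟨hu.1.le, hu.2.le⟩
  have hs : 0 < Real.sin ((1 - α) * u) :=
    Real.sin_pos_of_pos_of_lt_pi (mul_pos (by linarith) hu.1) (by nlinarith [hu.1, hu.2])
  obtain ⟨r', hr'⟩ : ∃ r', HasDerivAt (sinRatio α) r' u := by
    have h : DifferentiableAt ℝ (fun u => Real.sin (α * u) / Real.sin ((1 - α) * u)) u :=
      DifferentiableAt.div (by fun_prop) (by fun_prop) hs.ne'
    refine ⟨_, (h.hasDerivAt).congr_of_eventuallyEq ?_⟩
    filter_upwards [isOpen_ne.mem_nhds hu.1.ne'] with v hv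
    exact sinRatio_eq hα0 hα1 hv
  have hc := sum_choose_mul_sinRatio_rpow_mul_exp hα0 hα1 hu n
  simp only [Complex.exp_mul_I, ← Complex.ofReal_cos, ← Complex.ofReal_sin] at hc
  have hre := congrArg Complex.re hc
  have him := congrArg Complex.im hc
  simp only [Complex.re_sum, Complex.im_sum, Complex.add_re, Complex.add_im, Complex.ofReal_re,
    Complex.ofReal_im, Complex.mul_re, Complex.mul_im, Complex.I_re, Complex.I_im, mul_zero,
    mul_one, zero_mul, zero_add, add_zero, sub_zero] at hre him
  have hd : HasDerivAt (kanterPrimitive α n)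
      (∑ k ∈ Finset.range (n + 1), (n.choose k : ℝ) *
        ((r' * ((k : ℝ) - α * n) * sinRatio α u ^ ((k : ℝ) - α * n - 1)) *
          (u * Real.sinc ((k - α * n) * u)) +
        sinRatio α u ^ ((k : ℝ) - α * n) * Real.cos ((k - α * n) * u))) u := by
    unfold kanterPrimitive
    refine HasDerivAt.fun_sum fun k _ => HasDerivAt.const_mul _ (HasDerivAt.mul ?_ ?_)
    · exact hr'.rpow_const (Or.inl hr.ne')
    · exact mul_sinc_mul_hasDerivAt _
  -- The terms with `r'` add up to `r'/r` times the vanishing imaginary part `him`; the cosine terms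
  -- are the real part `hre`.
  convert hd using 1
  have : ∀ k : ℕ, (n.choose k : ℝ) *
        ((r' * ((k : ℝ) - α * n) * sinRatio α u ^ ((k : ℝ) - α * n - 1)) *
          (u * Real.sinc ((k - α * n) * u)) +
        sinRatio α u ^ ((k : ℝ) - α * n) * Real.cos ((k - α * n) * u)) =
      r' / sinRatio α u * (n.choose k * sinRatio α u ^ ((k : ℝ) - α * n) *
        Real.sin ((k - α * n) * u)) +
      n.choose k * sinRatio α u ^ ((k : ℝ) - α * n) * Real.cos ((k - α * n) * u) := by
    intro k
    rw [← mul_mul_sinc, Real.rpow_sub_one hr.ne']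
    field_simp
  rw [Finset.sum_congr rfl fun k _ => this k, Finset.sum_add_distrib, ← Finset.mul_sum, him, ← hre]
  simp

theorem integral_kanter_pow {α : ℝ} (hα0 : 0 < α) (hα1 : α < 1) (n : ℕ) :
    ∫ u in (0 : ℝ)..Real.pi, kanter α u ^ n =
      Real.pi * (n.factorial *
        ((Real.Gamma (α * n + 1))⁻¹ * (Real.Gamma ((1 - α) * n + 1))⁻¹)) := by
  have hcont : ContinuousOn (fun u => kanter α u ^ n) (Set.uIcc 0 Real.pi) := by
    rw [Set.uIcc_of_le Real.pi_pos.le]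
    exact (continuousOn_kanter hα0 hα1).pow n
  rw [intervalIntegral.integral_eq_sub_of_hasDerivAt_of_le Real.pi_pos.le
    (continuousOn_kanterPrimitive hα0 hα1 n)
    (fun u hu => hasDerivAt_kanterPrimitive hα0 hα1 hu n) hcont.intervalIntegrable]
  have h0 : kanterPrimitive α n 0 = 0 := by simp [kanterPrimitive]
  -- At `u = π` all powers of `sinRatio` become `1`, which leaves `π` times the sum in
  -- `sum_choose_mul_sinc` at `x = α n`.
  have h1 : sinRatio α Real.pi = 1 := by
    rw [sinRatio_eq hα0 hα1 Real.pi_ne_zero, sub_mul, one_mul, Real.sin_pi_sub, div_self]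
    exact (Real.sin_pos_of_pos_of_lt_pi (by positivity) (by nlinarith [Real.pi_pos])).ne'
  rw [h0, sub_zero, kanterPrimitive, h1, show (1 - α) * n + 1 = n - α * n + 1 by ring,
    ← sum_choose_mul_sinc, Finset.mul_sum]
  refine Finset.sum_congr rfl fun k _ => ?_
  rw [Real.one_rpow, mul_comm ((k : ℝ) - α * n)]
  ring

/-! ### The standard exponential law -/

instance isProbabilityMeasure_expMeasure_one : IsProbabilityMeasure (expMeasure 1) :=
  isProbabilityMeasure_expMeasure one_pos

theorem expMeasure_one_eq : expMeasure 1 =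
    (volume.restrict (Set.Ioi 0)).withDensity fun x => ENNReal.ofReal (Real.exp (-x)) := by
  rw [← withDensity_indicator measurableSet_Ioi, expMeasure, gammaMeasure]
  refine withDensity_congr_ae ?_
  filter_upwards [Measure.ae_ne volume (0 : ℝ)] with x hx
  rcases lt_or_gt_of_ne hx with h | h
  · rw [gammaPDF_of_neg h, Set.indicator_of_notMem (by simpa using h.le)]
  · rw [gammaPDF_of_nonneg h.le, Set.indicator_of_mem (by simpa using h)]
    simp

theorem ae_pos_expMeasure : ∀ᵐ x ∂expMeasure 1, 0 < x := by
  rw [expMeasure_one_eq]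
  exact (withDensity_absolutelyContinuous _ _).ae_le (ae_restrict_mem measurableSet_Ioi)

theorem integral_expMeasure_one {E : Type*} [NormedAddCommGroup E] [NormedSpace ℝ E] (f : ℝ → E) :
    ∫ x, f x ∂expMeasure 1 = ∫ x in Set.Ioi 0, Real.exp (-x) • f x := by
  rw [expMeasure_one_eq, integral_withDensity_eq_integral_toReal_smul (by fun_prop) (by simp)]
  simp [ENNReal.toReal_ofReal (Real.exp_pos _).le]

theorem integrable_expMeasure_one_iff (f : ℝ → ℝ) :
    Integrable f (expMeasure 1) ↔ IntegrableOn (fun x => Real.exp (-x) * f x) (Set.Ioi 0) := by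
  rw [expMeasure_one_eq, integrable_withDensity_iff_integrable_smul' (by fun_prop) (by simp)]
  simp [ENNReal.toReal_ofReal (Real.exp_pos _).le, IntegrableOn]

theorem integral_rpow_expMeasure {s : ℝ} (hs : 0 ≤ s) :
    ∫ x, x ^ s ∂expMeasure 1 = Real.Gamma (s + 1) := by
  rw [integral_expMeasure_one, Real.Gamma_eq_integral (by linarith)]
  simp

theorem integrable_rpow_expMeasure {s : ℝ} (hs : 0 ≤ s) :
    Integrable (fun x : ℝ => x ^ s) (expMeasure 1) := by
  rw [integrable_expMeasure_one_iff]
  simpa using Real.GammaIntegral_convergent (s := s + 1) (by linarith)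

theorem lintegral_exp_neg_mul_expMeasure {s : ℝ} (hs : 0 ≤ s) :
    ∫⁻ x, ENNReal.ofReal (Real.exp (-(s * x))) ∂expMeasure 1 = ENNReal.ofReal (1 + s)⁻¹ := by
  have hi : Integrable (fun x => Real.exp (-(s * x))) (expMeasure 1) := by
    rw [integrable_expMeasure_one_iff]
    have := exp_neg_integrableOn_Ioi 0 (show 0 < 1 + s by linarith)
    refine this.congr (ae_of_all _ fun x => ?_)
    simp only
    rw [← Real.exp_add]
    ring_nf
  rw [← ofReal_integral_eq_lintegral_ofReal hi (ae_of_all _ fun x => (Real.exp_pos _).le)]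
  congr 1
  rw [integral_expMeasure_one]
  have := integral_exp_mul_Ioi (a := -(1 + s)) (by linarith) 0
  simp only [smul_eq_mul, ← Real.exp_add]
  calc _ = ∫ x in Set.Ioi 0, Real.exp (-(1 + s) * x) := by congr with x; ring_nf
    _ = _ := by rw [this, neg_div_neg_eq]; simp

theorem expMeasure_Ioi {a : ℝ} (ha : 0 ≤ a) :
    expMeasure 1 (Set.Ioi a) = ENNReal.ofReal (Real.exp (-a)) := by
  rw [expMeasure_one_eq, withDensity_apply _ measurableSet_Ioi,
    Measure.restrict_restrict measurableSet_Ioi,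
    Set.inter_eq_left.mpr (Set.Ioi_subset_Ioi ha),
    ← ofReal_integral_eq_lintegral_ofReal (by simpa [IntegrableOn] using exp_neg_integrableOn_Ioi a one_pos)
      (ae_of_all _ fun x => (Real.exp_pos _).le), integral_exp_neg_Ioi]

theorem expMeasure_Ici {a : ℝ} (ha : 0 ≤ a) :
    expMeasure 1 (Set.Ici a) = ENNReal.ofReal (Real.exp (-a)) := by
  rw [← expMeasure_Ioi ha]
  refine measure_congr ?_
  have : (volume.restrict (Set.Ioi (0:ℝ))).withDensity
      (fun x => ENNReal.ofReal (Real.exp (-x))) ≪ volume :=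
    (withDensity_absolutelyContinuous _ _).trans Measure.restrict_le_self.absolutelyContinuous
  rw [expMeasure_one_eq]
  exact (this.ae_eq Ioi_ae_eq_Ici).symm

/-! ### Determination of the exponential law by its moments -/

/-- A law on `[0, ∞)` whose `n`-th moment is `n!` for every `n` has exponential moments of every
order `t < 1`. -/
theorem integrable_exp_mul_of_moments {μ : Measure ℝ} [IsProbabilityMeasure μ]
    (hpos : ∀ᵐ x ∂μ, 0 ≤ x) (hint : ∀ n : ℕ, Integrable (fun x => x ^ n) μ)
    (hmom : ∀ n : ℕ, ∫ x, x ^ n ∂μ = n.factorial) {t : ℝ} (ht : t < 1) :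
    Integrable (fun x => Real.exp (t * x)) μ := by
  -- On `[0, ∞)` a negative exponent is dominated by the exponent `0`. For `s ≥ 0` the exponential
  -- series integrates termwise to the geometric series in `s`.
  suffices h : ∀ s : ℝ, 0 ≤ s → s < 1 → Integrable (fun x => Real.exp (s * x)) μ by
    refine (h (max t 0) (le_max_right _ _) (by simp [ht])).mono' (by fun_prop) ?_
    filter_upwards [hpos] with x hx
    rw [Real.norm_eq_abs, abs_of_pos (Real.exp_pos _)]
    exact Real.exp_le_exp.mpr (mul_le_mul_of_nonneg_right (le_max_left _ _) hx)
  intro s hs0 hs1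
  refine ⟨by fun_prop, ?_⟩
  rw [hasFiniteIntegral_iff_ofReal (ae_of_all _ fun x => (Real.exp_pos _).le)]
  have h1 : ∫⁻ x, ENNReal.ofReal (Real.exp (s * x)) ∂μ =
      ∫⁻ x, ∑' n : ℕ, ENNReal.ofReal ((s * x) ^ n / n.factorial) ∂μ := by
    refine lintegral_congr_ae ?_
    filter_upwards [hpos] with x hx
    have := NormedSpace.expSeries_div_hasSum_exp (𝔸 := ℝ) (s * x)
    rw [← Real.exp_eq_exp_ℝ] at this
    rw [← this.tsum_eq]
    exact ENNReal.ofReal_tsum_of_nonneg (fun n => by positivity) this.summable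
  rw [h1, lintegral_tsum (by fun_prop)]
  have h2 : ∀ n : ℕ, ∫⁻ x, ENNReal.ofReal ((s * x) ^ n / n.factorial) ∂μ =
      ENNReal.ofReal (s ^ n) := by
    intro n
    rw [← ofReal_integral_eq_lintegral_ofReal]
    · simp only [mul_pow, mul_div_assoc]
      rw [integral_const_mul, integral_div, hmom, div_self (by positivity), mul_one]
    · simpa only [mul_pow] using ((hint n).const_mul _).div_const _
    · filter_upwards [hpos] with x hx
      positivity
  simp only [h2]
  rw [← ENNReal.ofReal_tsum_of_nonneg (fun n => by positivity)
    (summable_geometric_of_lt_one hs0 hs1)]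
  exact ENNReal.ofReal_lt_top

/-- A law on `[0, ∞)` is determined by its moments if these are `n!`. -/
theorem ext_of_moments_factorial {μ ν : Measure ℝ} [IsProbabilityMeasure μ]
    [IsProbabilityMeasure ν] (hμ : ∀ᵐ x ∂μ, 0 ≤ x) (hν : ∀ᵐ x ∂ν, 0 ≤ x)
    (hμi : ∀ n : ℕ, Integrable (fun x => x ^ n) μ) (hνi : ∀ n : ℕ, Integrable (fun x => x ^ n) ν)
    (hμm : ∀ n : ℕ, ∫ x, x ^ n ∂μ = n.factorial) (hνm : ∀ n : ℕ, ∫ x, x ^ n ∂ν = n.factorial) :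
    μ = ν := by
  have hint : ∀ {ρ : Measure ℝ} [IsProbabilityMeasure ρ], (∀ᵐ x ∂ρ, 0 ≤ x) →
      (∀ n : ℕ, Integrable (fun x => x ^ n) ρ) → (∀ n : ℕ, ∫ x, x ^ n ∂ρ = n.factorial) →
      Set.Iio 1 ⊆ interior (integrableExpSet id ρ) := by
    intro ρ _ h1 h2 h3
    rw [← interior_Iio]
    exact interior_mono fun t ht => integrable_exp_mul_of_moments h1 h2 h3 ht
  have han : ∀ {ρ : Measure ℝ} [IsProbabilityMeasure ρ], (∀ᵐ x ∂ρ, 0 ≤ x) →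
      (∀ n : ℕ, Integrable (fun x => x ^ n) ρ) → (∀ n : ℕ, ∫ x, x ^ n ∂ρ = n.factorial) →
      AnalyticOnNhd ℂ (complexMGF id ρ) {z | z.re < 1} := fun h1 h2 h3 =>
    analyticOnNhd_complexMGF.mono fun z hz => hint h1 h2 h3 hz
  have hder : ∀ {ρ : Measure ℝ} [IsProbabilityMeasure ρ], (∀ᵐ x ∂ρ, 0 ≤ x) →
      (∀ n : ℕ, Integrable (fun x => x ^ n) ρ) → (∀ n : ℕ, ∫ x, x ^ n ∂ρ = n.factorial) →
      ∀ n : ℕ, iteratedDeriv n (complexMGF id ρ) 0 = n.factorial := by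
    intro ρ _ h1 h2 h3 n
    rw [iteratedDeriv_complexMGF (hint h1 h2 h3 (by simp))]
    simp only [id, zero_mul, Complex.exp_zero, mul_one, ← Complex.ofReal_pow]
    rw [integral_complex_ofReal, h3, Complex.ofReal_natCast]
  -- Both transforms have the same Taylor coefficients at `0`, hence agree near `0`, and then on the
  -- half-plane `Re z < 1`, which contains the imaginary axis and so the characteristic functions.
  have heq : complexMGF id μ =ᶠ[nhds 0] complexMGF id ν := by
    have e1 := (han hμ hμi hμm 0 (by simp)).hasFPowerSeriesAt
    have e2 := (han hν hνi hνm 0 (by simp)).hasFPowerSeriesAt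
    simp only [hder hμ hμi hμm] at e1
    simp only [hder hν hνi hνm] at e2
    obtain ⟨r, hr⟩ := e1.sub e2
    rw [sub_self] at hr
    filter_upwards [HasFPowerSeriesAt.eventually_eq_zero ⟨r, hr⟩] with z hz
    exact sub_eq_zero.mp hz
  have hconv : Convex ℝ {z : ℂ | z.re < 1} := convex_halfSpace_re_lt 1
  have hon := (han hμ hμi hμm).eqOn_of_preconnected_of_eventuallyEq (han hν hνi hνm)
    hconv.isPreconnected (z₀ := 0) (by simp) heq
  refine Measure.ext_of_charFun (funext fun t => ?_)
  rw [← complexMGF_id_mul_I, ← complexMGF_id_mul_I]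
  exact hon (by simp)

/-! ### Kanter's representation of the positive stable law -/

/-- The uniform law on `(0, π)`. -/
noncomputable def uniformAngle : Measure ℝ :=
  ENNReal.ofReal Real.pi⁻¹ • volume.restrict (Set.Ioo 0 Real.pi)

instance : IsProbabilityMeasure uniformAngle where
  measure_univ := by
    rw [uniformAngle, Measure.smul_apply, Measure.restrict_apply_univ, Real.volume_Ioo, sub_zero,
      smul_eq_mul, ← ENNReal.ofReal_mul (by positivity), inv_mul_cancel₀ Real.pi_ne_zero,
      ENNReal.ofReal_one]

theorem ae_mem_uniformAngle : ∀ᵐ u ∂uniformAngle, u ∈ Set.Ioo 0 Real.pi :=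
  Measure.ae_smul_measure (ae_restrict_mem measurableSet_Ioo) _

theorem integral_kanter_pow_uniformAngle {α : ℝ} (hα0 : 0 < α) (hα1 : α < 1) (n : ℕ) :
    ∫ u, kanter α u ^ n ∂uniformAngle =
      n.factorial * ((Real.Gamma (α * n + 1))⁻¹ * (Real.Gamma ((1 - α) * n + 1))⁻¹) := by
  rw [uniformAngle, integral_smul_measure, ENNReal.toReal_ofReal (by positivity),
    ← integral_Ioc_eq_integral_Ioo, ← intervalIntegral.integral_of_le Real.pi_pos.le,
    integral_kanter_pow hα0 hα1, smul_eq_mul, inv_mul_cancel_left₀ Real.pi_ne_zero]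

theorem integrable_kanter_pow_uniformAngle {α : ℝ} (hα0 : 0 < α) (hα1 : α < 1) (n : ℕ) :
    Integrable (fun u => kanter α u ^ n) uniformAngle := by
  refine Integrable.smul_measure ?_ (by simp)
  exact (((continuousOn_kanter hα0 hα1).pow n).integrableOn_Icc).mono_set Set.Ioo_subset_Icc_self

/-- The law of an independent pair of an exponential variable and a uniform angle. -/
noncomputable def expAngle : Measure (ℝ × ℝ) := (expMeasure 1).prod uniformAngle

instance : IsProbabilityMeasure expAngle := by unfold expAngle; infer_instance

/-- Under `expAngle`, the `-α`-th power of a positive `α`-stable variable. -/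
noncomputable def mittagLeffler (α : ℝ) (q : ℝ × ℝ) : ℝ := q.1 ^ (1 - α) * kanter α q.2

theorem measurable_mittagLeffler (α : ℝ) : Measurable (mittagLeffler α) := by
  have := measurable_kanter α
  unfold mittagLeffler
  fun_prop

theorem ae_pos_expAngle {α : ℝ} (hα0 : 0 < α) (hα1 : α < 1) :
    ∀ᵐ q ∂expAngle, 0 < q.1 ∧ 0 < kanter α q.2 := by
  have h1 : ∀ᵐ q ∂expAngle, 0 < q.1 := Measure.quasiMeasurePreserving_fst.ae ae_pos_expMeasure
  have h2 : ∀ᵐ q ∂expAngle, q.2 ∈ Set.Ioo 0 Real.pi :=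
    Measure.quasiMeasurePreserving_snd.ae ae_mem_uniformAngle
  filter_upwards [h1, h2] with q hq1 hq2
  exact ⟨hq1, kanter_pos hα0 hα1 hq2⟩

theorem ae_pos_mittagLeffler {α : ℝ} (hα0 : 0 < α) (hα1 : α < 1) :
    ∀ᵐ q ∂expAngle, 0 < mittagLeffler α q := by
  filter_upwards [ae_pos_expAngle hα0 hα1] with q hq
  have h1 := hq.1
  have h2 := hq.2
  unfold mittagLeffler
  positivity

/-- If `E`, `W` are exponential and `U` is a uniform angle, independent, then
`E ^ α * W ^ (1 - α) * kanter α U` is exponential. -/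
theorem map_rpow_mul_mittagLeffler {α : ℝ} (hα0 : 0 < α) (hα1 : α < 1) :
    ((expMeasure 1).prod expAngle).map (fun p => p.1 ^ α * mittagLeffler α p.2) =
      expMeasure 1 := by
  have hm : Measurable fun p : ℝ × ℝ × ℝ => p.1 ^ α * mittagLeffler α p.2 := by
    have := measurable_mittagLeffler α
    fun_prop
  have := Measure.isProbabilityMeasure_map (μ := (expMeasure 1).prod expAngle) hm.aemeasurable
  have hpos : ∀ᵐ p ∂(expMeasure 1).prod expAngle,
      0 < p.1 ∧ 0 < p.2.1 ∧ 0 < kanter α p.2.2 := by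
    have h1 : ∀ᵐ p ∂(expMeasure 1).prod expAngle, 0 < p.1 :=
      Measure.quasiMeasurePreserving_fst.ae ae_pos_expMeasure
    have h2 : ∀ᵐ p ∂(expMeasure 1).prod expAngle, 0 < p.2.1 ∧ 0 < kanter α p.2.2 :=
      Measure.quasiMeasurePreserving_snd.ae (ae_pos_expAngle hα0 hα1)
    filter_upwards [h1, h2] with p hp1 hp2
    exact ⟨hp1, hp2⟩
  have hpow : ∀ n : ℕ, (fun p : ℝ × ℝ × ℝ => (p.1 ^ α * mittagLeffler α p.2) ^ n)
      =ᵐ[(expMeasure 1).prod expAngle] fun p =>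
        p.1 ^ (α * n) * (p.2.1 ^ ((1 - α) * n) * kanter α p.2.2 ^ n) := by
    intro n
    filter_upwards [hpos] with p hp
    rw [mittagLeffler, mul_pow, mul_pow, Real.rpow_mul hp.1.le, Real.rpow_mul hp.2.1.le,
      Real.rpow_natCast, Real.rpow_natCast]
  have hs : ∀ n : ℕ, 0 ≤ (1 - α) * n := fun n => mul_nonneg (by linarith) n.cast_nonneg
  have hint : ∀ n : ℕ, Integrable (fun p : ℝ × ℝ × ℝ =>
      p.1 ^ (α * n) * (p.2.1 ^ ((1 - α) * n) * kanter α p.2.2 ^ n))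
      ((expMeasure 1).prod expAngle) := fun n =>
    (integrable_rpow_expMeasure (by positivity)).mul_prod
      ((integrable_rpow_expMeasure (hs n)).mul_prod (integrable_kanter_pow_uniformAngle hα0 hα1 n))
  refine ext_of_moments_factorial ?_ (ae_pos_expMeasure.mono fun _ h => h.le) ?_ ?_ ?_ ?_
  · rw [ae_map_iff hm.aemeasurable measurableSet_Ici]
    filter_upwards [hpos] with p hp
    obtain ⟨h1, h2, h3⟩ := hp
    unfold mittagLeffler
    positivity
  · intro n
    rw [integrable_map_measure (by fun_prop) hm.aemeasurable]
    exact (hint n).congr (hpow n).symm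
  · intro n
    simpa using integrable_rpow_expMeasure n.cast_nonneg
  · intro n
    rw [integral_map hm.aemeasurable (by fun_prop), integral_congr_ae (hpow n),
      integral_prod_mul (fun x : ℝ => x ^ (α * n))
        (fun q : ℝ × ℝ => q.1 ^ ((1 - α) * n) * kanter α q.2 ^ n), expAngle,
      integral_prod_mul (fun x : ℝ => x ^ ((1 - α) * n)) (fun u => kanter α u ^ n),
      integral_rpow_expMeasure (by positivity), integral_rpow_expMeasure (hs n),
      integral_kanter_pow_uniformAngle hα0 hα1]
    -- The Gamma factors from the two exponential variables cancel those in the kernel's moment,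
    -- leaving `n!`.
    have g1 := (Real.Gamma_pos_of_pos (show 0 < α * n + 1 by positivity)).ne'
    have g2 := (Real.Gamma_pos_of_pos (show 0 < (1 - α) * n + 1 by linarith [hs n])).ne'
    generalize Real.Gamma (α * n + 1) = x at g1 ⊢
    generalize Real.Gamma ((1 - α) * n + 1) = y at g2 ⊢
    field_simp
  · intro n
    have := integral_rpow_expMeasure n.cast_nonneg
    simpa [Real.Gamma_nat_eq_factorial] using this

/-- The Laplace transform of the positive `α`-stable law, in Kanter's representation. -/
theorem lintegral_exp_neg_mul_mittagLeffler {α t : ℝ} (hα0 : 0 < α) (hα1 : α < 1) (ht : 0 ≤ t) :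
    ∫⁻ q, ENNReal.ofReal (Real.exp (-(t * mittagLeffler α q ^ (-α⁻¹)))) ∂expAngle =
      ENNReal.ofReal (Real.exp (-t ^ α)) := by
  have hm : Measurable fun p : ℝ × ℝ × ℝ => p.1 ^ α * mittagLeffler α p.2 := by
    have := measurable_mittagLeffler α
    fun_prop
  -- With `X = mittagLeffler α q ^ (-α⁻¹)`, both sides are `P(E > tX)`: conditioning on `X` gives
  -- the left side, while `E > tX` means `E^α X^(-α) > t^α`, where `E^α X^(-α)` is exponential.
  rw [← expMeasure_Ioi (by positivity : 0 ≤ t ^ α), ← map_rpow_mul_mittagLeffler hα0 hα1,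
    Measure.map_apply hm measurableSet_Ioi, Measure.prod_apply_symm (hm measurableSet_Ioi)]
  refine lintegral_congr_ae ?_
  filter_upwards [ae_pos_mittagLeffler hα0 hα1] with q hq
  rw [← expMeasure_Ioi (by positivity)]
  refine measure_congr ?_
  filter_upwards [ae_pos_expMeasure] with e he
  refine propext ?_
  change t * mittagLeffler α q ^ (-α⁻¹) < e ↔ t ^ α < e ^ α * mittagLeffler α q
  have hX : 0 < mittagLeffler α q ^ (-α⁻¹) := by positivity
  have h1 : (t * mittagLeffler α q ^ (-α⁻¹)) ^ α = t ^ α / mittagLeffler α q := by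
    rw [Real.mul_rpow ht hX.le, ← Real.rpow_mul hq.le, neg_mul, inv_mul_cancel₀ hα0.ne',
      Real.rpow_neg_one, div_eq_mul_inv]
  rw [← div_lt_iff₀ hq, ← h1, Real.rpow_lt_rpow_iff (by positivity) he.le hα0]

theorem integral_exp_neg_mul_mittagLeffler {α t : ℝ} (hα0 : 0 < α) (hα1 : α < 1) (ht : 0 ≤ t) :
    ∫ q, Real.exp (-(t * mittagLeffler α q ^ (-α⁻¹))) ∂expAngle = Real.exp (-t ^ α) := by
  have hm := measurable_mittagLeffler α
  rw [integral_eq_lintegral_of_nonneg_ae (ae_of_all _ fun x => (Real.exp_pos _).le)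
    (Measurable.aestronglyMeasurable (by fun_prop)), lintegral_exp_neg_mul_mittagLeffler hα0 hα1 ht,
    ENNReal.toReal_ofReal (Real.exp_pos _).le]

/-! ### The characteristic function of the Cauchy law -/

theorem integral_exp_neg_Ioi_mul_I (s : ℝ) :
    ∫ v in Set.Ioi (0 : ℝ), Complex.exp ((-1 + s * Complex.I) * v) = (1 - s * Complex.I)⁻¹ := by
  rw [integral_exp_mul_complex_Ioi (by simp)]
  simp only [Complex.ofReal_zero, mul_zero, Complex.exp_zero]
  rw [show -1 + s * Complex.I = -(1 - s * Complex.I) by ring, neg_div_neg_eq, one_div]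

theorem integrable_exp_neg_abs : Integrable fun v : ℝ => (Real.exp (-|v|) : ℂ) := by
  refine Integrable.ofReal (f := fun v : ℝ => Real.exp (-|v|)) ?_
  rw [← integrableOn_univ, ← Set.Iic_union_Ioi (a := (0 : ℝ)), integrableOn_union]
  constructor
  · refine (integrableOn_exp_Iic 0).congr_fun (fun x hx => ?_) measurableSet_Iic
    simp only [abs_of_nonpos (Set.mem_Iic.mp hx), neg_neg]
  · refine (exp_neg_integrableOn_Ioi 0 one_pos).congr_fun (fun x hx => ?_) measurableSet_Ioi
    simp only [abs_of_pos (Set.mem_Ioi.mp hx), neg_mul, one_mul]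

theorem fourier_exp_neg_abs (w : ℝ) :
    𝓕 (fun v : ℝ => (Real.exp (-|v|) : ℂ)) w = ((2 / (1 + (2 * Real.pi * w) ^ 2) : ℝ) : ℂ) := by
  rw [Real.fourier_real_eq_integral_exp_smul]
  set s : ℝ := 2 * Real.pi * w with hs
  have hi : Integrable (fun v : ℝ =>
      Complex.exp (↑(-2 * Real.pi * v * w) * Complex.I) • (Real.exp (-|v|) : ℂ)) := by
    refine integrable_exp_neg_abs.mono (by fun_prop) (ae_of_all _ fun v => ?_)
    rw [norm_smul, Complex.norm_exp_ofReal_mul_I, one_mul]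
  rw [← integral_add_compl measurableSet_Ioi hi (s := Set.Ioi 0), Set.compl_Ioi,
    ← neg_zero, ← integral_comp_neg_Ioi]
  have h1 : ∫ v in Set.Ioi (-0 : ℝ),
      Complex.exp (↑(-2 * Real.pi * v * w) * Complex.I) • (Real.exp (-|v|) : ℂ) =
      (1 + s * Complex.I)⁻¹ := by
    have := integral_exp_neg_Ioi_mul_I (-s)
    rw [neg_zero, ← sub_neg_eq_add, ← neg_mul, ← Complex.ofReal_neg, ← this]
    refine setIntegral_congr_fun measurableSet_Ioi fun v hv => ?_
    rw [abs_of_pos hv, smul_eq_mul, Complex.ofReal_exp, ← Complex.exp_add]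
    congr 1
    push_cast [hs]
    ring
  have h2 : ∫ v in Set.Ioi (0 : ℝ),
      Complex.exp (↑(-2 * Real.pi * -v * w) * Complex.I) • (Real.exp (-|-v|) : ℂ) =
      (1 - s * Complex.I)⁻¹ := by
    rw [← integral_exp_neg_Ioi_mul_I s]
    refine setIntegral_congr_fun measurableSet_Ioi fun v hv => ?_
    rw [abs_neg, abs_of_pos hv, smul_eq_mul, Complex.ofReal_exp, ← Complex.exp_add]
    congr 1
    push_cast [hs]
    ring
  rw [h1, h2]
  have e1 : (1 + s * Complex.I) ≠ 0 := fun h => by simpa using congrArg Complex.re h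
  have e2 : (1 - s * Complex.I) ≠ 0 := fun h => by simpa using congrArg Complex.re h
  have e3 : (1 + (s : ℂ) ^ 2) = (1 + s * Complex.I) * (1 - s * Complex.I) := by
    ring_nf
    rw [Complex.I_sq]
    ring
  push_cast
  rw [e3]
  field_simp
  ring

/-- Fourier inversion for `exp (-|v|)`, whose transform is the Cauchy density up to the substitution
`x = 2πw`. -/
theorem charFun_cauchyMeasure (t : ℝ) :
    charFun (cauchyMeasure 0 1) t = (Real.exp (-|t|) : ℂ) := by
  have hF : 𝓕 (fun v : ℝ => (Real.exp (-|v|) : ℂ)) =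
      fun w : ℝ => ((2 / (1 + (2 * Real.pi * w) ^ 2) : ℝ) : ℂ) := funext fourier_exp_neg_abs
  have hFi : Integrable fun w : ℝ => 2 / (1 + (2 * Real.pi * w) ^ 2) := by
    have := (integrable_inv_one_add_sq.comp_mul_left' (R := 2 * Real.pi) (by positivity)).const_mul 2
    simpa [div_eq_mul_inv] using this
  have hinv := congrFun (Continuous.fourierInv_fourier_eq (f := fun v : ℝ => (Real.exp (-|v|) : ℂ))
    (by fun_prop) integrable_exp_neg_abs (by rw [hF]; exact hFi.ofReal)) t
  rw [hF, Real.fourierInv_eq'] at hinv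
  rw [← hinv, charFun_apply_real, cauchyMeasure_of_scale_ne_zero _ one_ne_zero,
    integral_withDensity_eq_integral_toReal_smul (measurable_cauchyPDF 0 1)
      (by simp [cauchyPDF])]
  have hsub := Measure.integral_comp_mul_left (fun x : ℝ =>
    Complex.exp (t * x * Complex.I) * ((2 / (1 + x ^ 2) : ℝ) : ℂ)) (2 * Real.pi)
  calc _ = ∫ x : ℝ, ((2 * Real.pi)⁻¹ : ℝ) •
        (Complex.exp (t * x * Complex.I) * ((2 / (1 + x ^ 2) : ℝ) : ℂ)) := by
        refine integral_congr_ae (ae_of_all _ fun x => ?_)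
        simp only [cauchyPDF]
        rw [ENNReal.toReal_ofReal (cauchyPDF_pos 0 one_ne_zero x).le, cauchyPDFReal_def,
          Complex.real_smul, Complex.real_smul, mul_left_comm, mul_comm]
        congr 1
        rw [← Complex.ofReal_mul]
        congr 1
        simp
        field_simp
        ring
    _ = _ := by
        rw [integral_smul, ← abs_of_pos (a := (2 * Real.pi)⁻¹) (by positivity), ← hsub]
        refine integral_congr_ae (ae_of_all _ fun x => ?_)
        simp only [smul_eq_mul, RCLike.inner_apply, conj_trivial]
        congr 2
        push_cast
        ring

/-! ### Symmetric stable variables as mixtures, and the quotient `D/W` -/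

/-- The symmetric `α`-stable law is the law of a Cauchy variable times an independent positive
`α`-stable variable. -/
theorem IsStdStable.eq_map {α : ℝ} {μ : Measure ℝ} (hμ : IsStdStable α μ) (hα1 : α < 1) :
    μ = ((cauchyMeasure 0 1).prod expAngle).map
      (fun p => p.1 * mittagLeffler α p.2 ^ (-α⁻¹)) := by
  have hα0 := hμ.pos
  have := hμ.prob
  have hm : Measurable fun p : ℝ × ℝ × ℝ => p.1 * mittagLeffler α p.2 ^ (-α⁻¹) := by
    have := measurable_mittagLeffler α
    fun_prop
  have := Measure.isProbabilityMeasure_map (μ := (cauchyMeasure 0 1).prod expAngle) hm.aemeasurable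
  refine Measure.ext_of_charFun (funext fun t => ?_)
  have hi : Integrable (fun p : ℝ × ℝ × ℝ =>
      Complex.exp (t * (p.1 * mittagLeffler α p.2 ^ (-α⁻¹) : ℝ) * Complex.I))
      ((cauchyMeasure 0 1).prod expAngle) := by
    refine Integrable.of_bound (C := 1) (Measurable.aestronglyMeasurable (by fun_prop))
      (ae_of_all _ fun p => ?_)
    rw [← Complex.ofReal_mul, Complex.norm_exp_ofReal_mul_I]
  rw [hμ.charFun_eq, charFun_apply_real, integral_map hm.aemeasurable (by fun_prop),
    integral_prod_symm _ hi]
  -- Given the positive stable factor `X`, the Cauchy integral is `exp (-|t| X)`; averaging over `X`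
  -- is then its Laplace transform at `|t|`.
  have h1 : ∀ᵐ q ∂expAngle, ∫ c, Complex.exp (t * (c * mittagLeffler α q ^ (-α⁻¹) : ℝ) *
      Complex.I) ∂cauchyMeasure 0 1 =
      (Real.exp (-(|t| * mittagLeffler α q ^ (-α⁻¹))) : ℂ) := by
    filter_upwards [ae_pos_mittagLeffler hα0 hα1] with q hq
    have hX : 0 < mittagLeffler α q ^ (-α⁻¹) := by positivity
    have h := charFun_cauchyMeasure (t * mittagLeffler α q ^ (-α⁻¹))
    rw [charFun_apply_real, abs_mul, abs_of_pos hX] at h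
    rw [← h]
    congr with c
    push_cast
    ring_nf
  rw [integral_congr_ae h1, integral_complex_ofReal,
    integral_exp_neg_mul_mittagLeffler hα0 hα1 (abs_nonneg t), Complex.ofReal_exp,
    Complex.ofReal_neg]

theorem ae_ne_zero_cauchyMeasure : ∀ᵐ c ∂cauchyMeasure 0 1, c ≠ 0 := by
  rw [cauchyMeasure_of_scale_ne_zero _ one_ne_zero]
  exact (withDensity_absolutelyContinuous _ _).ae_le (Measure.ae_ne _ _)

/-- The law of an independent pair of a Cauchy variable and a uniform angle. -/
noncomputable def cauchyAngle : Measure (ℝ × ℝ) := (cauchyMeasure 0 1).prod uniformAngle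

instance : IsProbabilityMeasure cauchyAngle := by unfold cauchyAngle; infer_instance

/-- Under `cauchyAngle`, the numerator `D` in the representation `|s| ^ (α / (1 - α)) = D / W` of
a stable variable `s`, where `W` is exponential and independent of `D`. -/
noncomputable def stableNumerator (α : ℝ) (q : ℝ × ℝ) : ℝ :=
  |q.1| ^ (α / (1 - α)) * kanter α q.2 ^ (-(1 - α)⁻¹)

theorem measurable_stableNumerator (α : ℝ) : Measurable (stableNumerator α) := by
  have := measurable_kanter α
  unfold stableNumerator
  fun_prop

theorem ae_pos_stableNumerator {α : ℝ} (hα0 : 0 < α) (hα1 : α < 1) :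
    ∀ᵐ q ∂cauchyAngle, 0 < stableNumerator α q := by
  have h1 : ∀ᵐ q ∂cauchyAngle, q.1 ≠ 0 :=
    Measure.quasiMeasurePreserving_fst.ae ae_ne_zero_cauchyMeasure
  have h2 : ∀ᵐ q ∂cauchyAngle, q.2 ∈ Set.Ioo 0 Real.pi :=
    Measure.quasiMeasurePreserving_snd.ae ae_mem_uniformAngle
  filter_upwards [h1, h2] with q hq1 hq2
  have := kanter_pos hα0 hα1 hq2
  unfold stableNumerator
  positivity

/-- In the mixture, `W` enters `|s|` as `W^(-(1-α)/α)`; the power `α/(1-α)` is the one that turns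
this into `W⁻¹`, and the other factors form `stableNumerator`. -/
theorem IsStdStable.lintegral_abs_rpow {α : ℝ} {μ : Measure ℝ} (hμ : IsStdStable α μ)
    (hα1 : α < 1) {g : ℝ → ENNReal} (hg : Measurable g) :
    ∫⁻ b, g (|b| ^ (α / (1 - α))) ∂μ =
      ∫⁻ q, ∫⁻ w, g (stableNumerator α q / w) ∂expMeasure 1 ∂cauchyAngle := by
  have hα0 := hμ.pos
  have h1α : 0 < 1 - α := by linarith
  have hmX := measurable_mittagLeffler α
  have hmD := measurable_stableNumerator α
  rw [hμ.eq_map hα1, lintegral_map (by fun_prop) (by fun_prop)]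
  have h1 : ∀ᵐ p ∂(cauchyMeasure 0 1).prod expAngle,
      g (|p.1 * mittagLeffler α p.2 ^ (-α⁻¹)| ^ (α / (1 - α))) =
        g (stableNumerator α (p.1, p.2.2) / p.2.1) := by
    have := Measure.quasiMeasurePreserving_snd (μ := cauchyMeasure 0 1) (ν := expAngle) |>.ae
      (ae_pos_expAngle hα0 hα1)
    filter_upwards [this] with p hp
    obtain ⟨hw, hk⟩ := hp
    congr 1
    have e1 : -α⁻¹ * (α / (1 - α)) = -(1 - α)⁻¹ := by field_simp
    have e2 : (1 - α) * -(1 - α)⁻¹ = -1 := by field_simp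
    have hX : 0 ≤ mittagLeffler α p.2 := by unfold mittagLeffler; positivity
    rw [abs_mul, abs_of_nonneg (Real.rpow_nonneg hX _),
      Real.mul_rpow (abs_nonneg _) (Real.rpow_nonneg hX _), ← Real.rpow_mul hX, e1, mittagLeffler,
      Real.mul_rpow (Real.rpow_nonneg hw.le _) hk.le, ← Real.rpow_mul hw.le, e2, stableNumerator,
      Real.rpow_neg_one]
    field_simp
  rw [lintegral_congr_ae h1, cauchyAngle, lintegral_prod _ (by fun_prop),
    lintegral_prod _ (by fun_prop)]
  refine lintegral_congr fun c => ?_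
  rw [expAngle, lintegral_prod_symm _ (by fun_prop)]

theorem IsStdStable.ae_ne_zero {α : ℝ} {μ : Measure ℝ} (hμ : IsStdStable α μ) (hα1 : α < 1) :
    ∀ᵐ b ∂μ, b ≠ 0 := by
  have hα0 := hμ.pos
  have hmX := measurable_mittagLeffler α
  rw [hμ.eq_map hα1, ae_map_iff (by fun_prop) (p := fun b => b ≠ 0)
    (measurableSet_singleton 0).compl]
  have h1 := Measure.quasiMeasurePreserving_snd (μ := cauchyMeasure 0 1) (ν := expAngle) |>.ae
    (ae_pos_mittagLeffler hα0 hα1)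
  have h2 := Measure.quasiMeasurePreserving_fst (μ := cauchyMeasure 0 1) (ν := expAngle) |>.ae
    ae_ne_zero_cauchyMeasure
  filter_upwards [h1, h2] with p hp1 hp2
  positivity

/-! ### The ratio of two independent stable variables -/

theorem IsStdStable.measure_abs_le {α β : ℝ} {μ : Measure ℝ} (hμ : IsStdStable α μ)
    (hα1 : α < 1) (hβ : 0 < β) :
    μ {a | |a| ≤ β} =
      ∫⁻ q, ENNReal.ofReal (Real.exp (-(stableNumerator α q / β ^ (α / (1 - α)))))
        ∂cauchyAngle := by
  have hα0 := hμ.pos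
  have h1α : 0 < 1 - α := by linarith
  have h := hμ.lintegral_abs_rpow hα1
    (g := (Set.Iic (β ^ (α / (1 - α)))).indicator 1) (by fun_prop (disch := measurability))
  have hset : {a : ℝ | |a| ≤ β} =
      (fun b : ℝ => |b| ^ (α / (1 - α))) ⁻¹' Set.Iic (β ^ (α / (1 - α))) := by
    ext a
    simp only [Set.mem_ofPred_eq, Set.mem_preimage, Set.mem_Iic]
    rw [Real.rpow_le_rpow_iff (abs_nonneg _) hβ.le (by positivity)]
  rw [hset, ← lintegral_indicator_one (measurableSet_Iic.preimage (by fun_prop))]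
  change ∫⁻ b, (Set.Iic (β ^ (α / (1 - α)))).indicator 1 (|b| ^ (α / (1 - α))) ∂μ = _
  rw [h]
  refine lintegral_congr_ae ?_
  filter_upwards [ae_pos_stableNumerator hα0 hα1] with q hq
  rw [← expMeasure_Ici (by positivity), ← lintegral_indicator_one measurableSet_Ici]
  refine lintegral_congr_ae ?_
  filter_upwards [ae_pos_expMeasure] with w hw
  have : stableNumerator α q / w ≤ β ^ (α / (1 - α)) ↔
      stableNumerator α q / β ^ (α / (1 - α)) ≤ w := by
    rw [div_le_iff₀ hw, div_le_iff₀ (by positivity), mul_comm]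
  simp only [Set.indicator, Set.mem_Iic, Set.mem_Ici, this, Pi.one_apply]

/-- Given `D` and the second variable, the event is an exponential tail `W ≥ D / (ψ|b|^(α/(1-α)))`,
with `ψ = r^(α/(1-α))`. Writing `|b|^(α/(1-α)) = D'/W'` makes its probability `exp (-c W')` with `c
= D/(ψ D')`, and integrating out `W'` gives `1/(1+c)`. -/
theorem IsStdStable.prod_abs_le_mul_abs {α r : ℝ} {μ : Measure ℝ} (hμ : IsStdStable α μ)
    (hα1 : α < 1) (hr : 0 < r) :
    (μ.prod μ) {p | |p.1| ≤ r * |p.2|} =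
      ∫⁻ q, ∫⁻ q', ENNReal.ofReal
        (1 + stableNumerator α q / (r ^ (α / (1 - α)) * stableNumerator α q'))⁻¹
        ∂cauchyAngle ∂cauchyAngle := by
  have hα0 := hμ.pos
  have := hμ.prob
  have hmD := measurable_stableNumerator α
  have hmeas : MeasurableSet {p : ℝ × ℝ | |p.1| ≤ r * |p.2|} :=
    measurableSet_le (by fun_prop) (by fun_prop)
  rw [Measure.prod_apply_symm hmeas]
  have h1 : ∀ᵐ b ∂μ, μ ((fun a => (a, b)) ⁻¹' {p : ℝ × ℝ | |p.1| ≤ r * |p.2|}) =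
      ∫⁻ q, ENNReal.ofReal (Real.exp (-(stableNumerator α q /
        (r ^ (α / (1 - α)) * |b| ^ (α / (1 - α)))))) ∂cauchyAngle := by
    filter_upwards [hμ.ae_ne_zero hα1] with b hb
    rw [← Real.mul_rpow hr.le (abs_nonneg b), ← hμ.measure_abs_le hα1 (by positivity)]
    rfl
  rw [lintegral_congr_ae h1, lintegral_lintegral_swap (by fun_prop)]
  refine lintegral_congr_ae ?_
  filter_upwards [ae_pos_stableNumerator hα0 hα1] with q hq
  rw [hμ.lintegral_abs_rpow hα1 (g := fun z => ENNReal.ofReal (Real.exp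
    (-(stableNumerator α q / (r ^ (α / (1 - α)) * z))))) (by fun_prop)]
  refine lintegral_congr_ae ?_
  filter_upwards [ae_pos_stableNumerator hα0 hα1] with q' hq'
  rw [← lintegral_exp_neg_mul_expMeasure (by positivity)]
  refine lintegral_congr_ae ?_
  filter_upwards [ae_pos_expMeasure] with w hw
  congr 3
  field_simp

/-- After clearing denominators the difference is `ψ(1-ψ)(a-b)²`, with equality at `a = b`. -/
theorem two_mul_div_one_add_le {ψ a b : ℝ} (hψ0 : 0 < ψ) (hψ1 : ψ ≤ 1) (ha : 0 < a) (hb : 0 < b) :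
    2 * (ψ / (1 + ψ)) ≤ (1 + a / (ψ * b))⁻¹ + (1 + b / (ψ * a))⁻¹ := by
  have e1 : (1 + a / (ψ * b))⁻¹ = ψ * b / (ψ * b + a) := by field_simp
  have e2 : (1 + b / (ψ * a))⁻¹ = ψ * a / (ψ * a + b) := by field_simp
  rw [e1, e2, div_add_div _ _ (by positivity) (by positivity), ← mul_div_assoc,
    div_le_div_iff₀ (by positivity) (by positivity), ← sub_nonneg]
  have : (ψ * b * (ψ * a + b) + (ψ * b + a) * (ψ * a)) * (1 + ψ) -
      2 * ψ * ((ψ * b + a) * (ψ * a + b)) = ψ * (1 - ψ) * (a - b) ^ 2 := by ring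
  rw [this]
  have : 0 ≤ 1 - ψ := by linarith
  positivity

theorem IsStdStable.le_prod_abs_le_mul_abs {α r : ℝ} {μ : Measure ℝ} (hμ : IsStdStable α μ)
    (hα1 : α < 1) (hr : 0 < r) (hψ : r ^ (α / (1 - α)) ≤ 1) :
    ENNReal.ofReal (r ^ (α / (1 - α)) / (1 + r ^ (α / (1 - α)))) ≤
      (μ.prod μ) {p | |p.1| ≤ r * |p.2|} := by
  have hα0 := hμ.pos
  have hmD := measurable_stableNumerator α
  rw [hμ.prod_abs_le_mul_abs hα1 hr]
  set ψ := r ^ (α / (1 - α)) with hψdef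
  have hψ0 : 0 < ψ := by positivity
  set D := stableNumerator α
  set I := ∫⁻ q, ∫⁻ q', ENNReal.ofReal (1 + D q / (ψ * D q'))⁻¹ ∂cauchyAngle ∂cauchyAngle with hI
  -- `D` and `D'` have the same law, so `2I` is the integral of the symmetrized integrand, which is
  -- bounded below pointwise.
  have hswap : I = ∫⁻ q, ∫⁻ q', ENNReal.ofReal (1 + D q' / (ψ * D q))⁻¹
      ∂cauchyAngle ∂cauchyAngle := by
    rw [hI, lintegral_lintegral_swap (by fun_prop)]
  have h2 : 2 * ENNReal.ofReal (ψ / (1 + ψ)) ≤ 2 * I := by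
    calc 2 * ENNReal.ofReal (ψ / (1 + ψ)) =
        ∫⁻ _q, ∫⁻ _q', ENNReal.ofReal (2 * (ψ / (1 + ψ))) ∂cauchyAngle ∂cauchyAngle := by
          simp [ENNReal.ofReal_mul]
      _ ≤ ∫⁻ q, ∫⁻ q', (ENNReal.ofReal (1 + D q / (ψ * D q'))⁻¹ +
            ENNReal.ofReal (1 + D q' / (ψ * D q))⁻¹) ∂cauchyAngle ∂cauchyAngle := by
          refine lintegral_mono_ae ?_
          filter_upwards [ae_pos_stableNumerator hα0 hα1] with q hq
          refine lintegral_mono_ae ?_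
          filter_upwards [ae_pos_stableNumerator hα0 hα1] with q' hq'
          have hq : 0 < D q := hq
          have hq' : 0 < D q' := hq'
          rw [← ENNReal.ofReal_add (by positivity) (by positivity)]
          exact ENNReal.ofReal_le_ofReal (two_mul_div_one_add_le hψ0 hψ hq hq')
      _ = 2 * I := by
          rw [two_mul]
          nth_rw 2 [hswap]
          rw [hI, ← lintegral_add_left (by fun_prop)]
          refine lintegral_congr fun q => ?_
          rw [lintegral_add_left (by fun_prop)]
  exact (ENNReal.mul_le_mul_iff_right two_ne_zero ENNReal.ofNat_ne_top).mp h2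

/-! ### Stability of linear combinations and independence in the design -/

theorem IsStdStable.unique {α : ℝ} {μ ν : Measure ℝ} (hμ : IsStdStable α μ)
    (hν : IsStdStable α ν) : μ = ν := by
  have := hμ.prob
  have := hν.prob
  exact Measure.ext_of_charFun (funext fun t => by rw [hμ.charFun_eq, hν.charFun_eq])

theorem isStdStable_map_sum_mul {Ω ι : Type*} [MeasurableSpace Ω] [Fintype ι] {P : Measure Ω}
    [IsProbabilityMeasure P] {α : ℝ} (hα0 : 0 < α) (hα2 : α ≤ 2) {X : ι → Ω → ℝ}
    (hX : ∀ k, Measurable (X k)) (hind : iIndepFun X P) (hlaw : ∀ k, IsStdStable α (P.map (X k)))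
    {c : ι → ℝ} (hc : ∑ k, |c k| ^ α = 1) :
    IsStdStable α (P.map fun ω => ∑ k, c k * X k ω) where
  pos := hα0
  le_two := hα2
  prob := Measure.isProbabilityMeasure_map (Measurable.aemeasurable (by fun_prop))
  charFun_eq t := by
    have h := (hind.comp (fun k x => c k * x) (fun k => by fun_prop)).charFun_map_fun_sum_eq_prod
      (fun k => Measurable.aemeasurable (by fun_prop))
    simp only [Function.comp_apply] at h
    rw [h, Finset.prod_apply]
    have hk : ∀ k, charFun (P.map ((fun x => c k * x) ∘ X k)) t =
        Complex.exp (-((|c k| ^ α * |t| ^ α : ℝ) : ℂ)) := by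
      intro k
      have := charFun_map_mul_comp (μ := P) (hX k).aemeasurable (c k) t
      rw [(hlaw k).charFun_eq, abs_mul, Real.mul_rpow (abs_nonneg _) (abs_nonneg _)] at this
      exact this
    rw [Finset.prod_congr rfl fun k _ => hk k, ← Complex.exp_sum, Finset.sum_neg_distrib,
      ← Complex.ofReal_sum, ← Finset.sum_mul, hc, one_mul]

/-- The rows of an independent doubly indexed family are independent. -/
theorem iIndepFun_curry {Ω ι κ : Type*} [MeasurableSpace Ω] {P : Measure Ω}
    [IsProbabilityMeasure P] {X : κ → ι → Ω → ℝ} (hm : ∀ j i, Measurable (X j i))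
    (hind : iIndepFun (fun (p : κ × ι) => X p.1 p.2) P) :
    iIndepFun (fun (j : κ) (ω : Ω) (i : ι) => X j i ω) P := by
  have hp : ∀ (j : κ) (i : ι), IsProbabilityMeasure (P.map (X j i)) :=
    fun j i => Measure.isProbabilityMeasure_map (hm j i).aemeasurable
  rw [iIndepFun_iff_map_fun_eq_infinitePi_map (by fun_prop)]
  have hcol : ∀ j, P.map (fun ω i => X j i ω) = Measure.infinitePi fun i => P.map (X j i) :=
    fun j => (hind.precomp (g := fun i => (j, i))
      fun _ _ h => (Prod.mk.inj h).2).map_fun_eq_infinitePi_map fun i => hm j i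
  simp only [hcol]
  have hjoint := hind.map_fun_eq_infinitePi_map fun p : κ × ι => hm p.1 p.2
  rw [← Measure.infinitePi_map_curry (fun j i => P.map (X j i)), ← hjoint,
    Measure.map_map (by fun_prop) (by fun_prop)]
  rfl

/-- A zero coefficient removes `X i` from the sum, which is thus a function of the remaining
variables. -/
theorem indepFun_sum_mul_of_eq_zero {Ω ι : Type*} [MeasurableSpace Ω] [Fintype ι] {P : Measure Ω}
    {X : ι → Ω → ℝ} (hX : ∀ k, Measurable (X k)) (hind : iIndepFun X P) {c : ι → ℝ} {i : ι}
    (hi : c i = 0) : IndepFun (fun ω => ∑ k, c k * X k ω) (X i) P := by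
  classical
  have h := hind.indepFun_finset (Finset.univ.erase i) {i} (by simp) hX
  have hφ : Measurable fun v : ↥(Finset.univ.erase i) → ℝ =>
      ∑ k : ↥(Finset.univ.erase i), c k * v k := by
    fun_prop
  have hψ : Measurable fun v : ↥({i} : Finset ι) → ℝ => v ⟨i, by simp⟩ := by fun_prop
  have h2 := h.comp hφ hψ
  have hsum : (fun ω => ∑ k, c k * X k ω) = fun ω =>
      ∑ k : ↥(Finset.univ.erase i), c k * X k ω := by
    funext ω
    rw [Finset.sum_coe_sort (Finset.univ.erase i) (fun k => c k * X k ω),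
      Finset.sum_erase _ (by simp [hi])]
  rw [hsum]
  exact h2

/-! ### Tail bounds at a single zero coordinate -/

theorem theta_pos {N : ℕ} (α : ℝ) {x : Fin N → ℝ} (hx : x ≠ 0) : 0 < theta α x := by
  obtain ⟨i, hi⟩ := Function.ne_iff.mp hx
  have : 0 < ∑ i, |x i| ^ α :=
    Finset.sum_pos' (fun k _ => by positivity)
      ⟨i, Finset.mem_univ i, Real.rpow_pos_of_pos (abs_pos.mpr hi) _⟩
  unfold theta
  positivity

theorem sum_abs_div_theta_rpow {N : ℕ} {α : ℝ} (hα0 : 0 < α) {x : Fin N → ℝ} (hx : x ≠ 0) :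
    ∑ k, |x k / theta α x| ^ α = 1 := by
  have hθ := theta_pos α hx
  have hs : 0 ≤ ∑ i, |x i| ^ α := Finset.sum_nonneg fun k _ => by positivity
  have hθα : theta α x ^ α = ∑ i, |x i| ^ α := by
    rw [theta, ← Real.rpow_mul hs, one_div, inv_mul_cancel₀ hα0.ne', Real.rpow_one]
  have : ∀ k, |x k / theta α x| ^ α = |x k| ^ α / theta α x ^ α := fun k => by
    rw [abs_div, abs_of_pos hθ, Real.div_rpow (abs_nonneg _) hθ.le]
  rw [Finset.sum_congr rfl fun k _ => this k, ← Finset.sum_div, ← hθα,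
    div_self (by positivity)]

section Design

variable {Ω : Type*} [MeasurableSpace Ω] {P : Measure Ω} {N M : ℕ} {α ε : ℝ} {x : Fin N → ℝ} {S : Ω → Matrix (Fin N) (Fin M) ℝ}

theorem psi_pos (hε : 0 < ε) (hx : x ≠ 0) : 0 < psi α ε x := by
  have := theta_pos α hx
  unfold psi
  positivity

theorem IsStableDesign.measurable_ratioStat (hS : IsStableDesign P α S) (i : Fin N) (j : Fin M) :
    Measurable fun ω => ratioStat (x ᵥ* S ω) (S ω) i j := by
  have := hS.measurable_entry
  unfold ratioStat
  simp only [Matrix.vecMul, dotProduct]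
  fun_prop

theorem IsStableDesign.measureReal_lt_abs_ratioStat_le [IsProbabilityMeasure P]
    (hS : IsStableDesign P α S) (hα1 : α < 1) (hε : 0 < ε) (hx : x ≠ 0) (hψ : psi α ε x ≤ 1) {i : Fin N} (hi : x i = 0) (j : Fin M) :
    P.real {ω | ε < |ratioStat (x ᵥ* S ω) (S ω) i j|} ≤ (1 + psi α ε x)⁻¹ := by
  have hα0 := (hS.law_entry i j).pos
  have hθ := theta_pos α hx
  have hψ0 := psi_pos (α := α) hε hx
  have hcol : iIndepFun (fun k ω => S ω k j) P :=
    hS.indep.precomp (g := fun k => (k, j)) fun _ _ h => (Prod.mk.inj h).1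
  have hmk : ∀ k, Measurable fun ω => S ω k j := fun k => hS.measurable_entry k j
  have hind := indepFun_sum_mul_of_eq_zero hmk hcol (c := fun k => x k / theta α x) (i := i)
    (by simp [hi])
  have hlaw := isStdStable_map_sum_mul hα0 (by linarith) hmk hcol (fun k => hS.law_entry k j)
    (sum_abs_div_theta_rpow hα0 hx)
  have hle := (hS.law_entry i j).le_prod_abs_le_mul_abs hα1 (div_pos hε hθ) hψ
  -- The first copy of the stable law is realized by the normalized measurement `y_j / θ`, the
  -- second by `s_{ij}`.
  nth_rw 1 [← hlaw.unique (hS.law_entry i j)] at hle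
  rw [← hind.map_prod_eq_prod_map_map (by fun_prop) (by fun_prop),
    Measure.map_apply (by fun_prop) (measurableSet_le (by fun_prop) (by fun_prop))] at hle
  have hmeas : MeasurableSet {ω | ε < |ratioStat (x ᵥ* S ω) (S ω) i j|} := by
    have := hS.measurable_ratioStat (x := x) i j
    exact measurableSet_lt (by fun_prop) (by fun_prop)
  have hsub : (fun ω => (∑ k, x k / theta α x * S ω k j, S ω i j)) ⁻¹'
      {p : ℝ × ℝ | |p.1| ≤ ε / theta α x * |p.2|} ⊆
      {ω | ε < |ratioStat (x ᵥ* S ω) (S ω) i j|}ᶜ := by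
    intro ω hω
    have hω : |∑ k, x k / theta α x * S ω k j| ≤ ε / theta α x * |S ω i j| := hω
    have hsum : ∑ k, x k / theta α x * S ω k j = (x ᵥ* S ω) j / theta α x := by
      simp only [Matrix.vecMul, dotProduct, Finset.sum_div, div_mul_eq_mul_div]
    rw [hsum, abs_div, abs_of_pos hθ, div_mul_eq_mul_div, div_le_div_iff_of_pos_right hθ] at hω
    change ¬ ε < |(x ᵥ* S ω) j / S ω i j|
    rw [not_lt, abs_div]
    -- This also covers `S ω i j = 0`, where the ratio is `0` by convention and does not exceed `ε`.
    exact div_le_of_le_mul₀ (abs_nonneg _) hε.le hω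
  have h1 : psi α ε x / (1 + psi α ε x) ≤
      P.real {ω | ε < |ratioStat (x ᵥ* S ω) (S ω) i j|}ᶜ := by
    refine (ENNReal.ofReal_le_iff_le_toReal (measure_ne_top _ _)).mp (hle.trans ?_)
    exact measure_mono hsub
  rw [probReal_compl_eq_one_sub hmeas] at h1
  have h2 : psi α ε x / (1 + psi α ε x) = 1 - (1 + psi α ε x)⁻¹ := by
    field_simp
    ring
  linarith

theorem lt_abs_minEstimator_iff [NeZero M] (y : Fin M → ℝ) (A : Matrix (Fin N) (Fin M) ℝ)
    (i : Fin N) : ε < |minEstimator y A i| ↔ ∀ j, ε < |ratioStat y A i j| :=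
  ⟨fun h j => h.trans_le (absArgmin_spec _ j), fun h => h _⟩

theorem IsStableDesign.measurableSet_lt_abs_minEstimator [NeZero M] (hS : IsStableDesign P α S)
    (i : Fin N) : MeasurableSet {ω | ε < |minEstimator (x ᵥ* S ω) (S ω) i|} := by
  simp only [lt_abs_minEstimator_iff, Set.ofPred_forall]
  refine MeasurableSet.iInter fun j => ?_
  have := hS.measurable_ratioStat (x := x) i j
  exact measurableSet_lt (by fun_prop) (by fun_prop)

/-- The minimum exceeds `ε` exactly when every ratio does, and the `j`-th ratio depends only on the
`j`-th column of `S`; the columns are independent. -/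
theorem IsStableDesign.measureReal_lt_abs_minEstimator_le [NeZero M] [IsProbabilityMeasure P]
    (hS : IsStableDesign P α S) (hα1 : α < 1) (hε : 0 < ε) (hx : x ≠ 0) (hψ : psi α ε x ≤ 1) {i : Fin N} (hi : x i = 0) :
    P.real {ω | ε < |minEstimator (x ᵥ* S ω) (S ω) i|} ≤ ((1 + psi α ε x)⁻¹) ^ M := by
  have hcols := iIndepFun_curry (X := fun j i ω => S ω i j) (fun j i => hS.measurable_entry i j)
    (hS.indep.precomp (g := Prod.swap) Prod.swap_injective)
  have hB : MeasurableSet {v : Fin N → ℝ | ε < |(∑ k, x k * v k) / v i|} :=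
    measurableSet_lt (by fun_prop) (by fun_prop)
  have h := hcols.meas_iInter (s := fun j => {ω | ε < |ratioStat (x ᵥ* S ω) (S ω) i j|})
    fun j => ⟨_, hB, rfl⟩
  simp only [lt_abs_minEstimator_iff, Set.ofPred_forall]
  rw [measureReal_def, h, ENNReal.toReal_prod]
  refine (Finset.prod_le_prod (fun j _ => ENNReal.toReal_nonneg) fun j _ =>
    hS.measureReal_lt_abs_ratioStat_le hα1 hε hx hψ hi j).trans_eq ?_
  simp

end Design

/-! ### Counting false positives -/

theorem mul_inv_one_add_pow_le {n ψ δ : ℝ} (M : ℕ) (hn : 0 ≤ n) (hδ : 0 < δ) (hψ : 0 < ψ)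
    (hM : Real.log (n / δ) / Real.log (1 + ψ) ≤ M) : n * ((1 + ψ)⁻¹) ^ M ≤ δ := by
  -- For `n = 0`, that is `N = K`, `Real.log 0 = 0` makes the condition on `M` void, and the bound
  -- is trivial.
  rcases hn.eq_or_lt with rfl | hn
  · simpa using hδ.le
  · rw [div_le_iff₀ (Real.log_pos (by linarith)), ← Real.log_pow,
      Real.log_le_log_iff (by positivity) (by positivity), div_le_iff₀ hδ] at hM
    rw [inv_pow, ← div_eq_mul_inv, div_le_iff₀ (by positivity)]
    linarith

end StableCS

theorem mainTheorem3 {Ω : Type*} [MeasurableSpace Ω] (P : Measure Ω) [IsProbabilityMeasure P]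
    (N M K : ℕ) [NeZero M] (α ε δ : ℝ) (hα0 : 0 < α) (hα1 : α < 1) (hε : 0 < ε) (hδ : 0 < δ)
    (x : Fin N → ℝ) (hx : x ≠ 0) (hK : Finset.card {i | x i ≠ 0} = K)
    (S : Ω → Matrix (Fin N) (Fin M) ℝ) (hS : StableCS.IsStableDesign P α S)
    (hψ : StableCS.psi α ε x ≤ 1 / 3)
    (hM : Real.log (((N : ℝ) - (K : ℝ)) / δ) / Real.log (1 + StableCS.psi α ε x) ≤ (M : ℝ)) :
    Integrable (fun ω => ((StableCS.falsePositives ε x (S ω)).card : ℝ)) P ∧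
      ∫ ω, ((StableCS.falsePositives ε x (S ω)).card : ℝ) ∂P ≤ δ ∧
      1 - δ ≤ P.real {ω | StableCS.falsePositives ε x (S ω) = ∅} := by
  classical
  set Z : Finset (Fin N) := {i | x i = 0} with hZ
  set F : Fin N → Set Ω := fun i => {ω | ε < |StableCS.minEstimator (x ᵥ* S ω) (S ω) i|} with hF
  have hFm : ∀ i, MeasurableSet (F i) := fun i => hS.measurableSet_lt_abs_minEstimator i
  -- As a sum of indicators, the count has expectation `∑ P(F i)`, which is also the union bound for
  -- the event of some false positive; one estimate `hsum` serves both claims.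
  have hcard : ∀ ω, ((StableCS.falsePositives ε x (S ω)).card : ℝ) =
      ∑ i ∈ Z, (F i).indicator 1 ω := by
    intro ω
    have : StableCS.falsePositives ε x (S ω) = Z.filter fun i => ω ∈ F i := by
      ext i
      simp [StableCS.falsePositives, hZ, hF]
    rw [this, Finset.card_filter]
    push_cast
    refine Finset.sum_congr rfl fun i _ => ?_
    simp [Set.indicator_apply]
  have hZcard : (Z.card : ℝ) = N - K := by
    have := Finset.card_filter_add_card_filter_not (s := (Finset.univ : Finset (Fin N)))
      (fun i => x i = 0)
    rw [hK, Finset.card_univ, Fintype.card_fin] at this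
    rw [eq_sub_iff_add_eq]
    exact_mod_cast this
  have hψ0 := StableCS.psi_pos (α := α) hε hx
  have hsum : ∑ i ∈ Z, P.real (F i) ≤ δ := by
    refine (Finset.sum_le_card_nsmul Z _ (((1 + StableCS.psi α ε x)⁻¹) ^ M) fun i hi =>
      hS.measureReal_lt_abs_minEstimator_le hα1 hε hx (by linarith)
        (by simpa [hZ] using hi)).trans ?_
    rw [nsmul_eq_mul]
    refine StableCS.mul_inv_one_add_pow_le M Z.card.cast_nonneg hδ hψ0 ?_
    rwa [hZcard]
  have hint : ∀ i ∈ Z, Integrable ((F i).indicator (1 : Ω → ℝ)) P := fun i _ =>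
    (integrable_const (1 : ℝ)).indicator (hFm i)
  simp only [hcard]
  refine ⟨integrable_finsetSum _ hint, ?_, ?_⟩
  · rw [integral_finsetSum _ hint]
    simpa only [integral_indicator_one (hFm _)] using hsum
  · have hempty : {ω | StableCS.falsePositives ε x (S ω) = ∅} = (⋃ i ∈ Z, F i)ᶜ := by
      ext ω
      simp [StableCS.falsePositives, hZ, hF, Finset.filter_eq_empty_iff]
    rw [hempty, probReal_compl_eq_one_sub (Finset.measurableSet_biUnion _ fun i _ => hFm i)]
    have := measureReal_biUnion_finset_le (μ := P) Z F
    linarith
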